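/- Let $D,E$ be finite sets, $n\ge 0$ an integer, $\mathcal D\subseteq D^n$ and $f:\mathcal D\to E$. For an integer $k>0$ let $f^{(k)}:\mathcal D^k\to E^k$, $f^{(k)}(x^1,\dots,x^k)=(f(x^1),\dots,f(x^k))$, be the function computing $k$ independent copies of $f$; its input is regarded as a string of length $kn$ over $D$. *Query complexity.* For $g:\mathcal C\to E'$ with $\mathcal C\subseteq D^N$, $Q_\epsilon(g)$ is the minimum number $T$ of queries of a quantum algorithm that on every input $x\in\mathcal C$ outputs $g(x)$ with probability at least $1-\epsilon$. Here an algorithm alternates arbitrary unitaries $U_0,\dots,U_T$ that do not depend on the input with $T$ applications of the query operator $O_x$ and ends with a measurement; the query operator acts on an index register, an answer register and a finite-dimensional workspace by $O_x|i,b,w\rangle=|i,b+x_i,w\rangle$ for $1\le i\le N$ and $O_x|{\rm none},b,w\rangle=|{\rm none},b,w\rangle$, where the answer register is indexed by an arbitrary finite abelian group $G$ into which $D$ is injected (for example $G=\mathbb Z/|D|\mathbb Z$). The result holds for every choice of $G$ and of the injection $D\hookrightarrow G$. *Additive adversary bound.* Let $J$ be the all-ones $\mathcal D\times\mathcal D$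 matrix, $F(x,y)=\delta_{f(x),f(y)}$ and $\Delta_i(x,y)=\delta_{x_i,y_i}$ for $x,y\in\mathcal D$, $1\le i\le n$, and let $\circ$ denote the entrywise product. Then $$\mathrm{ADV}(F)=\max\bigl\{\|\Gamma\circ(J-F)\| \;:\; \Gamma \text{ Hermitian},\ I\pm\Gamma\circ(J-\Delta_i)\succeq 0\text{ for all } 1\le i\le n\bigr\},$$ where $\Gamma$ ranges over complex $\mathcal D\times\mathcal D$ matrices and $\|\cdot\|$ is the spectral norm. **Theorem (strong direct product theorem).** For every such $f$, every real $\delta$ with $2/3\le\delta\le 1$ and every integer $k>0$, $$Q_{1-\delta^{k/2}}\bigl(f^{(k)}\bigr)\;\ge\;\frac{k\ln(3\delta/2)}{8}\,\mathrm{ADV}(F).$$ -/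

import Mathlib

open scoped Matrix ENNReal ComplexOrder

noncomputable section

namespace QuantumQuery

/-! ### Functions and independent copies -/

/-- The domain `𝒟 ^ k`, for `𝒟 ⊆ D ^ ι`, as a subset of `D ^ (k × ι)`: the string `x` consists of
the `k` blocks `x (p, ·)`, each of which has to lie in `𝒟`. -/
def powDomain {ι D : Type*} [Fintype ι] [DecidableEq ι] [Fintype D] [DecidableEq D]
    (k : ℕ) (𝒟 : Finset (ι → D)) : Finset (Fin k × ι → D) :=
  Finset.univ.filter fun x => ∀ p : Fin k, (fun i => x (p, i)) ∈ 𝒟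

/-- The function `f^(k) (x¹, …, xᵏ) = (f x¹, …, f xᵏ)`. -/
def funPow {ι D E : Type*} [Fintype ι] [DecidableEq ι] [Fintype D] [DecidableEq D]
    (k : ℕ) {𝒟 : Finset (ι → D)} (f : 𝒟 → E) : powDomain k 𝒟 → (Fin k → E) :=
  fun x p => f ⟨fun i => x.1 (p, i), (Finset.mem_filter.mp x.2).2 p⟩

/-! ### Quantum query algorithms -/

/-- The computational basis of the registers of an algorithm: an index register (where `none` means
that no position is queried), an answer register indexed by the group `G`, and an `m`-dimensional
workspace. -/
abbrev Basis (ι G : Type*) (m : ℕ) : Type _ := Option ι × G × Fin m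

/-- The query operator for the input `x`: it is the linear map with
`|i, b, w⟩ ↦ |i, b + enc (x i), w⟩` and `|none, b, w⟩ ↦ |none, b, w⟩`, written on amplitudes. -/
def query {ι D G : Type*} [AddCommGroup G] (enc : D ↪ G) (x : ι → D) {m : ℕ}
    (ψ : Basis ι G m → ℂ) : Basis ι G m → ℂ
  | (none, b, w) => ψ (none, b, w)
  | (some i, b, w) => ψ (some i, b - enc (x i), w)

/-- A quantum query algorithm with outputs in `E`: its number `T` of queries, the dimension of its
workspace, the input-independent unitaries `U 0, …, U T` (the other values of `U` are not used),
the basis state it starts in, and the output attached to each outcome of the final measurement in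
the computational basis. -/
structure Algorithm (ι G E : Type*) [Fintype ι] [DecidableEq ι] [Fintype G] [DecidableEq G] where
  numQueries : ℕ
  workDim : ℕ
  U : ℕ → Matrix.unitaryGroup (Basis ι G workDim) ℂ
  start : Basis ι G workDim
  out : Basis ι G workDim → E

namespace Algorithm

variable {ι D G E : Type*} [Fintype ι] [DecidableEq ι] [Fintype G] [DecidableEq G]
  [AddCommGroup G]

/-- The state `U t · O_x · U (t - 1) ⋯ O_x · U 0 |start⟩` after `t` queries on the input `x`. -/
def state (A : Algorithm ι G E) (enc : D ↪ G) (x : ι → D) : ℕ → (Basis ι G A.workDim → ℂ)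
  | 0 => (A.U 0 : Matrix _ _ ℂ) *ᵥ Pi.single A.start 1
  | t + 1 => (A.U (t + 1) : Matrix _ _ ℂ) *ᵥ query enc x (A.state enc x t)

/-- The probability that the algorithm outputs `e` on the input `x`. -/
def outputProb [DecidableEq E] (A : Algorithm ι G E) (enc : D ↪ G) (x : ι → D) (e : E) : ℝ :=
  ∑ b with A.out b = e, ‖A.state enc x A.numQueries b‖ ^ 2

/-- On every input in its domain, the algorithm outputs the value of `f` with error at most `ε`. -/
def Computes [DecidableEq E] (A : Algorithm ι G E) (enc : D ↪ G) (ε : ℝ)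
    {𝒟 : Finset (ι → D)} (f : 𝒟 → E) : Prop :=
  ∀ x : 𝒟, 1 - ε ≤ A.outputProb enc x.1 (f x)

end Algorithm

/-- The quantum query complexity `Q_ε(f)`: the least number of queries of an algorithm that
computes `f` with error at most `ε` (it is `⊤` if there is no such algorithm). -/
def queryComplexity {ι D G E : Type*} [Fintype ι] [DecidableEq ι] [Fintype G] [DecidableEq G]
    [AddCommGroup G] [DecidableEq E] (enc : D ↪ G) (ε : ℝ) {𝒟 : Finset (ι → D)} (f : 𝒟 → E) :
    ℕ∞ :=
  ⨅ (A : Algorithm ι G E) (_ : A.Computes enc ε f), (A.numQueries : ℕ∞)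

/-! ### The additive adversary bound -/

/-- The all-ones matrix `J`. -/
def allOnes (X : Type*) : Matrix X X ℂ := Matrix.of fun _ _ => 1

/-- The target Gram matrix `F (x, y) = δ_{f x, f y}` of a function. -/
def gram {X E : Type*} [DecidableEq E] (f : X → E) : Matrix X X ℂ :=
  Matrix.of fun x y => if f x = f y then 1 else 0

/-- The matrix `Δ_i (x, y) = δ_{x_i, y_i}`. -/
def agree {ι D : Type*} [DecidableEq D] (𝒟 : Finset (ι → D)) (i : ι) : Matrix 𝒟 𝒟 ℂ :=
  Matrix.of fun x y => if x.1 i = y.1 i then 1 else 0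

/-- The spectral norm of a matrix. -/
def specNorm {X : Type*} [Fintype X] [DecidableEq X] (M : Matrix X X ℂ) : ℝ :=
  ‖Matrix.toEuclideanCLM (n := X) (𝕜 := ℂ) M‖

/-- `Γ` is an additive adversary matrix: it is Hermitian and `I ± Γ ∘ (J - Δ_i) ⪰ 0` for all `i`. -/
def IsAdversaryMatrix {ι D : Type*} [Fintype ι] [DecidableEq D] (𝒟 : Finset (ι → D))
    (Γ : Matrix 𝒟 𝒟 ℂ) : Prop :=
  Γ.IsHermitian ∧ ∀ i : ι,
    (1 + Γ ⊙ (allOnes 𝒟 - agree 𝒟 i)).PosSemidef ∧ (1 - Γ ⊙ (allOnes 𝒟 - agree 𝒟 i)).PosSemidef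

/-- The additive adversary bound of a target Gram matrix `σ`: the maximum of `‖Γ ∘ (J - σ)‖` over
all additive adversary matrices `Γ`. -/
def advBound {ι D : Type*} [Fintype ι] [DecidableEq D] {𝒟 : Finset (ι → D)}
    (σ : Matrix 𝒟 𝒟 ℂ) : ℝ≥0∞ :=
  ⨆ (Γ : Matrix 𝒟 𝒟 ℂ) (_ : IsAdversaryMatrix 𝒟 Γ),
    ENNReal.ofReal (specNorm (Γ ⊙ (allOnes 𝒟 - σ)))

end QuantumQuery

end

/-!
Let `Γ` be an adversary matrix, `B = Γ ∘ (J - F)` and `d = ‖B‖`. Dividing `B` by an eigenvalue of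
modulus `d` gives a Hermitian `H` with `-I ≤ H ≤ I`, `H ∘ F = 0`, `H v = v` for a unit vector `v`,
and `-(2/d) I ≤ H ∘ (J - Δ_i) ≤ (2/d) I`. The matrix `S = 2 I - H` is a multiplicative adversary
matrix: one query changes the potential `∑_b Φ(·, b)* S Φ(·, b)` of a family `Φ` of states, indexed
by the inputs, by a factor of at most `1 + 4/d`, and unitaries that do not depend on the input leave
it unchanged. The class of such matrices is closed under tensor powers with the same factor, since
querying one of `k` inputs touches only one tensor factor.

Run an algorithm for `k` copies on the superposition `v^{⊗k}` of inputs, record the output, and run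
it backwards: `2 T` queries in total. With `M = S^{⊗k}`, the final overlap with the starting state is
the success probability, and Cauchy–Schwarz between `M` and `M⁻¹` bounds its square by the final
potential times `(v* (S⁻¹ ∘ F) v)^k`. As `v* S v = 1` and `v* (S⁻¹ ∘ F) v ≤ 2/3`, success
probability `δ^{k/2}` forces `δ^k ≤ (1 + 4/d)^{2 T} (2/3)^k`, and the theorem follows by taking
logarithms.
-/

namespace QuantumQuery

/-! ### Quadratic forms and operator intervals -/

section QuadForm

variable {X : Type*} [Fintype X]

/-- The real part of the quadratic form `u* M u`; for Hermitian `M` it is the whole form. -/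
noncomputable def quadForm (M : Matrix X X ℂ) (u : X → ℂ) : ℝ :=
  (star u ⬝ᵥ (M *ᵥ u)).re

theorem quadForm_eq_re_sum (M : Matrix X X ℂ) (u : X → ℂ) :
    quadForm M u = (∑ x, ∑ y, M x y * (star (u x) * u y)).re := by
  simp only [quadForm, dotProduct, Matrix.mulVec, Finset.mul_sum, Pi.star_apply]
  congr! 3 with x _ y
  ring

@[simp]
theorem quadForm_zero_right (M : Matrix X X ℂ) : quadForm M 0 = 0 := by
  simp [quadForm]

theorem quadForm_add_left (M N : Matrix X X ℂ) (u : X → ℂ) :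
    quadForm (M + N) u = quadForm M u + quadForm N u := by
  simp [quadForm, Matrix.add_mulVec]

theorem quadForm_sub_left (M N : Matrix X X ℂ) (u : X → ℂ) :
    quadForm (M - N) u = quadForm M u - quadForm N u := by
  simp [quadForm, Matrix.sub_mulVec]

theorem quadForm_smul_left (c : ℝ) (M : Matrix X X ℂ) (u : X → ℂ) :
    quadForm (c • M) u = c * quadForm M u := by
  simp [quadForm, Matrix.smul_mulVec]

theorem ofReal_sum_norm_sq (u : X → ℂ) : ((∑ x, ‖u x‖ ^ 2 : ℝ) : ℂ) = star u ⬝ᵥ u := by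
  simp [dotProduct, ← Complex.conj_mul']

theorem quadForm_of_mulVec_eq_smul {M : Matrix X X ℂ} {c : ℝ} {u : X → ℂ} (h : M *ᵥ u = c • u) :
    quadForm M u = c * ∑ x, ‖u x‖ ^ 2 := by
  rw [quadForm, h, dotProduct_smul, ← ofReal_sum_norm_sq, Complex.real_smul,
    ← Complex.ofReal_mul, Complex.ofReal_re]

theorem quadForm_one [DecidableEq X] (u : X → ℂ) : quadForm 1 u = ∑ x, ‖u x‖ ^ 2 := by
  rw [quadForm_of_mulVec_eq_smul (c := 1) (by rw [Matrix.one_mulVec, one_smul]), one_mul]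

theorem ofReal_quadForm {M : Matrix X X ℂ} (hM : M.PosSemidef) (u : X → ℂ) :
    (quadForm M u : ℂ) = star u ⬝ᵥ (M *ᵥ u) :=
  Complex.ext (Complex.ofReal_re _) (Complex.le_def.mp (hM.dotProduct_mulVec_nonneg u)).2

theorem quadForm_nonneg {M : Matrix X X ℂ} (hM : M.PosSemidef) (u : X → ℂ) :
    0 ≤ quadForm M u :=
  hM.re_dotProduct_nonneg u

theorem sq_re_dotProduct_le_mul_quadForm_inv [DecidableEq X] {M : Matrix X X ℂ} (hM : M.PosDef)
    (t u : X → ℂ) : (star t ⬝ᵥ u).re ^ 2 ≤ quadForm M u * quadForm M⁻¹ t := by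
  have hdet : IsUnit M.det := (Matrix.isUnit_iff_isUnit_det M).mp hM.isUnit
  have adjoint (z : X → ℂ) : star (M⁻¹ *ᵥ t) ⬝ᵥ z = star t ⬝ᵥ (M⁻¹ *ᵥ z) := by
    rw [Matrix.star_mulVec, hM.isHermitian.inv.eq, Matrix.dotProduct_mulVec]
  have symm : (star u ⬝ᵥ t).re = (star t ⬝ᵥ u).re := by
    rw [← Complex.conj_re (star t ⬝ᵥ u)]
    exact congrArg Complex.re (Matrix.star_dotProduct u t)
  have expand (s : ℝ) : quadForm M (s • u - M⁻¹ *ᵥ t) =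
      quadForm M u * (s * s) + -2 * (star t ⬝ᵥ u).re * s + quadForm M⁻¹ t := by
    simp only [quadForm, Matrix.mulVec_sub, Matrix.mulVec_smul, star_sub, star_smul, star_trivial,
      sub_dotProduct, dotProduct_sub, smul_dotProduct, dotProduct_smul, adjoint,
      Matrix.mulVec_mulVec, Matrix.mul_nonsing_inv M hdet, Matrix.nonsing_inv_mul M hdet,
      Matrix.one_mulVec, Complex.sub_re, Complex.real_smul, Complex.re_ofReal_mul, symm]
    ring
  have := discrim_le_zero fun s => (quadForm_nonneg hM.posSemidef _).trans_eq (expand s)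
  rw [discrim] at this
  linarith

theorem sq_sum_re_dotProduct_le_mul_sum_quadForm_inv {E : Type*} [DecidableEq X]
    {M : Matrix X X ℂ} (hM : M.PosDef) (S : Finset E) (t u : E → X → ℂ) :
    (∑ e ∈ S, (star (t e) ⬝ᵥ u e).re) ^ 2 ≤
      (∑ e ∈ S, quadForm M (u e)) * ∑ e ∈ S, quadForm M⁻¹ (t e) :=
  Finset.sum_sq_le_sum_mul_sum_of_sq_le_mul S (fun _ _ => quadForm_nonneg hM.posSemidef _)
    (fun _ _ => quadForm_nonneg hM.inv.posSemidef _)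
    fun e _ => sq_re_dotProduct_le_mul_quadForm_inv hM (t e) (u e)

end QuadForm

section Gram

variable {X E : Type*} [DecidableEq E]

theorem posSemidef_gram (g : X → E) : (gram g).PosSemidef := by
  have : gram g = (1 : Matrix E E ℂ).submatrix g g := by
    ext x y
    simp [gram, Matrix.one_apply]
  rw [this]
  exact Matrix.PosSemidef.one.submatrix g

theorem one_hadamard_gram [DecidableEq X] (g : X → E) : (1 : Matrix X X ℂ) ⊙ gram g = 1 :=
  Matrix.one_hadamard_eq_one_iff.mpr (by ext x; simp [gram])

theorem hadamard_allOnes_sub (M N : Matrix X X ℂ) : M ⊙ (allOnes X - N) = M - M ⊙ N := by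
  ext x y
  simp [allOnes, mul_sub]

theorem sum_quadForm_fiber_eq_quadForm_hadamard_gram [Fintype X] (K : Matrix X X ℂ) (g : X → E)
    {S : Finset E} (hS : ∀ x, g x ∈ S) (w : X → ℂ) :
    ∑ e ∈ S, quadForm K (fun x => if g x = e then w x else 0) = quadForm (K ⊙ gram g) w := by
  simp only [quadForm_eq_re_sum, ← Complex.re_sum]
  rw [Finset.sum_comm]
  congr! 2 with x
  rw [Finset.sum_comm]
  congr! 1 with y
  rw [Finset.sum_eq_single_of_mem (g x) (hS x) fun e _ he => by simp [he.symm]]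
  by_cases h : g x = g y <;> simp [gram, h, eq_comm]

end Gram

section Domination

theorem sub_hadamard {X : Type*} (A B C : Matrix X X ℂ) : (A - B) ⊙ C = A ⊙ C - B ⊙ C := by
  ext x y
  exact sub_mul _ _ _

variable {X : Type*} {L L' N N' : Matrix X X ℂ}

/-- `N` is dominated by `L` if `-L ⪯ N ⪯ L`. The defining inequalities of an additive adversary
matrix say that each `Γ ∘ (J - Δ_i)` is dominated by the identity. -/
def IsDominatedBy (N L : Matrix X X ℂ) : Prop :=
  (L + N).PosSemidef ∧ (L - N).PosSemidef

namespace IsDominatedBy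

theorem neg (h : IsDominatedBy N L) : IsDominatedBy (-N) L :=
  ⟨by simpa [sub_eq_add_neg] using h.2, by simpa using h.1⟩

theorem sub (h : IsDominatedBy N L) (h' : IsDominatedBy N' L') :
    IsDominatedBy (N - N') (L + L') := by
  have hadd : L + L' + (N - N') = (L + N) + (L' - N') := by abel
  have hsub : L + L' - (N - N') = (L - N) + (L' + N') := by abel
  exact ⟨hadd ▸ h.1.add h'.2, hsub ▸ h.2.add h'.1⟩

theorem smul (h : IsDominatedBy N L) (c : ℝ) : IsDominatedBy (c • N) (|c| • L) := by
  have of_nonneg {c : ℝ} (hc : 0 ≤ c) : IsDominatedBy (c • N) (c • L) :=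
    ⟨by simpa only [smul_add] using h.1.smul hc, by simpa only [smul_sub] using h.2.smul hc⟩
  rcases abs_cases c with ⟨habs, hc⟩ | ⟨habs, hc⟩
  · rw [habs]
    exact of_nonneg hc
  · rw [habs]
    simpa using (of_nonneg (neg_nonneg.mpr hc.le)).neg

theorem hadamard (h : IsDominatedBy N L) {P : Matrix X X ℂ} (hP : P.PosSemidef) :
    IsDominatedBy (N ⊙ P) (L ⊙ P) := by
  constructor
  · simpa only [Matrix.add_hadamard] using h.1.hadamard hP
  · simpa only [sub_hadamard] using h.2.hadamard hP

theorem abs_quadForm_le [Fintype X] (h : IsDominatedBy N L) (u : X → ℂ) :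
    |quadForm N u| ≤ quadForm L u := by
  have hadd := quadForm_nonneg h.1 u
  have hsub := quadForm_nonneg h.2 u
  rw [quadForm_add_left] at hadd
  rw [quadForm_sub_left] at hsub
  exact abs_le.mpr ⟨by linarith, by linarith⟩

end IsDominatedBy

theorem posDef_two_smul_one_sub [DecidableEq X] {H : Matrix X X ℂ} (hH : IsDominatedBy H 1) :
    ((2 : ℝ) • 1 - H).PosDef := by
  have : (2 : ℝ) • 1 - H = 1 + (1 - H) := by module
  exact this ▸ Matrix.PosDef.one.add_posSemidef hH.2

variable [Fintype X] [DecidableEq X] {A : Matrix X X ℂ}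

open scoped Matrix.Norms.L2Operator MatrixOrder in
theorem isDominatedBy_specNorm_smul_one (hA : A.IsHermitian) :
    IsDominatedBy A (specNorm A • 1) := by
  have hle {B : Matrix X X ℂ} (hB : B.IsHermitian) : (specNorm B • 1 - B).PosSemidef := by
    have h : B ≤ algebraMap ℝ _ ‖B‖ := IsSelfAdjoint.le_algebraMap_norm_self (ha := hB)
    rwa [Matrix.le_iff, Algebra.algebraMap_eq_smul_one] at h
  have hneg : specNorm (-A) = specNorm A := by simp [specNorm]
  exact ⟨by simpa [hneg] using hle hA.neg, hle hA⟩

open scoped Matrix.Norms.L2Operator MatrixOrder in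
theorem exists_mulVec_eq_smul_and_abs_eq_specNorm [Nonempty X] (hA : A.IsHermitian) :
    ∃ (c : ℝ) (v : X → ℂ), |c| = specNorm A ∧ ∑ x, ‖v x‖ ^ 2 = 1 ∧ A *ᵥ v = c • v := by
  obtain ⟨c, hc, j, rfl⟩ : ∃ c : ℝ, |c| = specNorm A ∧ c ∈ Set.range hA.eigenvalues := by
    rw [← hA.spectrum_real_eq_range_eigenvalues]
    have habs : |specNorm A| = specNorm A := abs_of_nonneg (norm_nonneg _)
    rcases CStarAlgebra.norm_or_neg_norm_mem_spectrum (a := A) hA with h | h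
    · exact ⟨specNorm A, habs, h⟩
    · exact ⟨-specNorm A, by rw [abs_neg, habs], h⟩
  refine ⟨_, hA.eigenvectorBasis j, hc, ?_, hA.mulVec_eigenvectorBasis j⟩
  rw [← EuclideanSpace.norm_sq_eq, hA.eigenvectorBasis.norm_eq_one, one_pow]

open scoped Matrix.Norms.L2Operator MatrixOrder in
/-- The operator form of `x + a * b / x ≤ a + b` for `a ≤ x ≤ b`. -/
theorem posSemidef_add_smul_one_sub_sub_smul_inv {a b : ℝ} (hA : A.PosDef)
    (ha : (A - a • 1).PosSemidef) (hb : (b • 1 - A).PosSemidef) :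
    ((a + b) • 1 - A - (a * b) • A⁻¹).PosSemidef := by
  have hdet : IsUnit A.det := (Matrix.isUnit_iff_isUnit_det A).mp hA.isUnit
  have hAinv : A * A⁻¹ = 1 := Matrix.mul_nonsing_inv A hdet
  have hinvA : A⁻¹ * A = 1 := Matrix.nonsing_inv_mul A hdet
  have hcomm : Commute (A - a • 1) (b • 1 - A) :=
    (((Commute.one_right A).smul_right b).sub_right (Commute.refl A)).sub_left
      ((Commute.one_left _).smul_left a)
  have hcomm' : Commute A⁻¹ ((A - a • 1) * (b • 1 - A)) := by
    have hone (c : ℝ) : Commute A⁻¹ (c • 1) := (Commute.one_right A⁻¹).smul_right c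
    have hinv : Commute A⁻¹ A := hinvA.trans hAinv.symm
    exact (hinv.sub_right (hone a)).mul_right ((hone b).sub_right hinv)
  have hfactor : (a + b) • 1 - A - (a * b) • A⁻¹ = A⁻¹ * ((A - a • 1) * (b • 1 - A)) := by
    rw [← mul_assoc, mul_sub A⁻¹, hinvA]
    simp only [sub_mul, mul_sub, mul_smul_comm, smul_mul_assoc, one_mul, mul_one, hinvA]
    module
  rw [hfactor]
  exact Matrix.nonneg_iff_posSemidef.mp
    (hcomm'.mul_nonneg hA.inv.posSemidef.nonneg (hcomm.mul_nonneg ha.nonneg hb.nonneg))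

/-- The constant is the maximum of `3 / (2 - h) - h` on `[-1, 1]`, attained at both ends. -/
theorem quadForm_inv_hadamard_gram_le {E : Type*} [DecidableEq E] {f : X → E} {H : Matrix X X ℂ}
    (hH : IsDominatedBy H 1) (hf : H ⊙ gram f = 0) (v : X → ℂ) :
    quadForm (((2 : ℝ) • 1 - H)⁻¹ ⊙ gram f) v ≤ 2 / 3 * ∑ x, ‖v x‖ ^ 2 := by
  set A := (2 : ℝ) • 1 - H with hA
  have ha : A - (1 : ℝ) • 1 = 1 - H := by rw [hA]; module
  have hb : (3 : ℝ) • 1 - A = 1 + H := by rw [hA]; module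
  have hinv : (((1 : ℝ) + 3) • 1 - A - ((1 : ℝ) * 3) • A⁻¹).PosSemidef :=
    posSemidef_add_smul_one_sub_sub_smul_inv (posDef_two_smul_one_sub hH) (ha ▸ hH.2) (hb ▸ hH.1)
  have hblock : (((1 : ℝ) + 3) • 1 - A - ((1 : ℝ) * 3) • A⁻¹) ⊙ gram f =
      (2 : ℝ) • 1 - (3 : ℝ) • (A⁻¹ ⊙ gram f) := by
    simp only [hA, sub_hadamard, Matrix.smul_hadamard, one_hadamard_gram, hf]
    module
  have := quadForm_nonneg (hblock ▸ hinv.hadamard (posSemidef_gram f)) v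
  rw [quadForm_sub_left, quadForm_smul_left, quadForm_smul_left, quadForm_one] at this
  linarith

end Domination

/-! ### The potential of a family of states -/

section Potential

variable {X B : Type*} [Fintype X] [Fintype B]

/-- The potential `∑_b Φ(·, b)* M Φ(·, b)` of a family of states, one for each input: the progress
measure of the multiplicative adversary method. -/
noncomputable def potential (M : Matrix X X ℂ) (Φ : X → B → ℂ) : ℝ :=
  ∑ b, quadForm M fun x => Φ x b

theorem potential_eq_re_sum (M : Matrix X X ℂ) (Φ : X → B → ℂ) :
    potential M Φ = (∑ x, ∑ y, M x y * (star (Φ x) ⬝ᵥ Φ y)).re := by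
  simp only [potential, quadForm_eq_re_sum, ← Complex.re_sum, dotProduct, Finset.mul_sum]
  rw [Finset.sum_comm]
  congr! 2 with x
  exact Finset.sum_comm

theorem potential_congr (M : Matrix X X ℂ) {Φ Ψ : X → B → ℂ}
    (h : ∀ x y, M x y = 0 ∨ star (Φ x) ⬝ᵥ Φ y = star (Ψ x) ⬝ᵥ Ψ y) :
    potential M Φ = potential M Ψ := by
  rw [potential_eq_re_sum, potential_eq_re_sum]
  congr! 3 with x _ y
  rcases h x y with h | h <;> simp [h]

theorem potential_mulVec [DecidableEq B] (M : Matrix X X ℂ) {U : Matrix B B ℂ} (hU : Uᴴ * U = 1)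
    (Φ : X → B → ℂ) : potential M (fun x => U *ᵥ Φ x) = potential M Φ :=
  potential_congr M fun x y => Or.inr <| by
    rw [Matrix.star_mulVec, Matrix.dotProduct_mulVec, Matrix.vecMul_vecMul, hU, Matrix.vecMul_one]

theorem potential_unitary_mulVec [DecidableEq B] (M : Matrix X X ℂ) (U : Matrix.unitaryGroup B ℂ)
    (Φ : X → B → ℂ) : potential M (fun x => U.1 *ᵥ Φ x) = potential M Φ :=
  potential_mulVec M (Matrix.UnitaryGroup.star_mul_self U) Φ

theorem potential_conjTranspose_mulVec [DecidableEq B] (M : Matrix X X ℂ)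
    (U : Matrix.unitaryGroup B ℂ) (Φ : X → B → ℂ) :
    potential M (fun x => U.1ᴴ *ᵥ Φ x) = potential M Φ :=
  potential_unitary_mulVec M (star U) Φ

theorem potential_sub_left (M N : Matrix X X ℂ) (Φ : X → B → ℂ) :
    potential (M - N) Φ = potential M Φ - potential N Φ := by
  simp only [potential, quadForm_sub_left, Finset.sum_sub_distrib]

theorem potential_smul_left (c : ℝ) (M : Matrix X X ℂ) (Φ : X → B → ℂ) :
    potential (c • M) Φ = c * potential M Φ := by
  simp only [potential, quadForm_smul_left, Finset.mul_sum]

theorem potential_nonneg {M : Matrix X X ℂ} (hM : M.PosSemidef) (Φ : X → B → ℂ) :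
    0 ≤ potential M Φ :=
  Finset.sum_nonneg fun _ _ => quadForm_nonneg hM _

theorem quadForm_le_potential {M : Matrix X X ℂ} (hM : M.PosSemidef) (Φ : X → B → ℂ) (b : B) :
    quadForm M (fun x => Φ x b) ≤ potential M Φ :=
  Finset.single_le_sum (f := fun b => quadForm M fun x => Φ x b)
    (fun _ _ => quadForm_nonneg hM _) (Finset.mem_univ b)

theorem sum_potential_fiber {E : Type*} [DecidableEq E] (M : Matrix X X ℂ) (Φ : X → B → ℂ)
    {out : B → E} {S : Finset E} (hS : ∀ b, out b ∈ S) :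
    ∑ e ∈ S, potential M (fun x b => if out b = e then Φ x b else 0) = potential M Φ := by
  simp only [potential]
  rw [Finset.sum_comm]
  congr! 1 with b
  rw [Finset.sum_eq_single_of_mem (out b) (hS b) fun e _ he => ?_]
  · simp only [if_true]
  · simp only [he.symm, if_false]
    exact quadForm_zero_right M

theorem IsDominatedBy.abs_potential_le {N L : Matrix X X ℂ} (h : IsDominatedBy N L)
    (Φ : X → B → ℂ) : |potential N Φ| ≤ potential L Φ :=
  (Finset.abs_sum_le_sum_abs _ _).trans (Finset.sum_le_sum fun _ _ => h.abs_quadForm_le _)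

theorem potential_eq_add_sum_sum {ι G : Type*} [Fintype ι] [Fintype G] {m : ℕ}
    (M : Matrix X X ℂ) (Φ : X → Basis ι G m → ℂ) :
    potential M Φ = potential M (fun x (p : G × Fin m) => Φ x (none, p)) +
      ∑ i, ∑ w, potential M fun x g => Φ x (some i, g, w) := by
  simp only [potential, Fintype.sum_prod_type, Fintype.sum_option]
  congr! 2 with i
  exact Finset.sum_comm

variable {V G : Type*} [Fintype G] [AddGroup G] {a : X → V} {s : X → G}

theorem potential_translate {R : Matrix X X ℂ} (hR : ∀ x y, a x ≠ a y → R x y = 0)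
    (hs : ∀ x y, a x = a y → s x = s y) (φ : X → G → ℂ) :
    potential R (fun x g => φ x (g - s x)) = potential R φ := by
  refine potential_congr R fun x y => ?_
  by_cases h : a x = a y
  · right
    simp only [dotProduct, Pi.star_apply, hs x y h]
    exact (Equiv.subRight (s y)).sum_comp fun g => star (φ x g) * φ y g
  · exact Or.inl (hR x y h)

/-- Only the part of `M` between inputs with distinct `a` notices the translation, and that part is
dominated by `κ • L` before as well as after it. -/
theorem potential_translate_le [DecidableEq V] {M L : Matrix X X ℂ} {κ : ℝ} (hκ : 0 ≤ κ)
    (hL : ∀ x y, a x ≠ a y → L x y = 0) (hLM : (M - L).PosSemidef)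
    (hN : IsDominatedBy (M ⊙ (allOnes X - gram a)) (κ • L))
    (hs : ∀ x y, a x = a y → s x = s y) (φ : X → G → ℂ) :
    potential M (fun x g => φ x (g - s x)) ≤ (1 + 2 * κ) * potential M φ := by
  set N := M ⊙ (allOnes X - gram a) with hNdef
  have hdiag : potential (M - N) (fun x g => φ x (g - s x)) = potential (M - N) φ :=
    potential_translate (fun x y h => by simp [hNdef, allOnes, gram, h]) hs φ
  have hLinv : potential L (fun x g => φ x (g - s x)) = potential L φ :=
    potential_translate hL hs φ
  have hbefore := (abs_le.mp (hN.abs_potential_le φ)).1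
  have hafter := (abs_le.mp (hN.abs_potential_le fun x g => φ x (g - s x))).2
  have hle : κ * potential L φ ≤ κ * potential M φ := by
    have := potential_nonneg hLM φ
    rw [potential_sub_left] at this
    exact mul_le_mul_of_nonneg_left (by linarith) hκ
  rw [potential_smul_left] at hbefore hafter
  rw [hLinv] at hafter
  rw [potential_sub_left, potential_sub_left] at hdiag
  linarith

end Potential

/-! ### Multiplicative adversary matrices -/

section Query

/-- `M` is a multiplicative adversary matrix for inputs `a x`: one query multiplies the potential of
`M` by at most `1 + 2 * κ`. The certificate is, for each position `i`, a lower bound `L` of `M` that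
does not mix inputs with distinct `i`-th symbols. -/
structure IsMultiplicativeAdversary {X ι D : Type*} [DecidableEq D] (a : X → ι → D) (κ : ℝ)
    (M : Matrix X X ℂ) : Prop where
  nonneg : 0 ≤ κ
  posDef : M.PosDef
  exists_le (i : ι) : ∃ L : Matrix X X ℂ, (∀ x y, a x i ≠ a y i → L x y = 0) ∧
    (M - L).PosSemidef ∧ IsDominatedBy (M ⊙ (allOnes X - gram fun x => a x i)) (κ • L)

variable {ι G : Type*} [AddCommGroup G] {m : ℕ}

/-- The operator `|i, b, w⟩ ↦ |i, b + s i, w⟩`, `|none, b, w⟩ ↦ |none, b, w⟩`. Both a query and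
its inverse are of this form. -/
def shift (s : ι → G) (ψ : Basis ι G m → ℂ) : Basis ι G m → ℂ
  | (none, b, w) => ψ (none, b, w)
  | (some i, b, w) => ψ (some i, b - s i, w)

theorem query_eq_shift {D : Type*} (enc : D ↪ G) (x : ι → D) (ψ : Basis ι G m → ℂ) :
    query enc x ψ = shift (fun i => enc (x i)) ψ := by
  ext ⟨i | i, b, w⟩ <;> rfl

theorem shift_smul (s : ι → G) (c : ℂ) (ψ : Basis ι G m → ℂ) :
    shift s (c • ψ) = c • shift s ψ := by
  ext ⟨i | i, b, w⟩ <;> rfl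

variable [Fintype ι] [Fintype G]

theorem star_shift_dotProduct (s : ι → G) (ψ φ : Basis ι G m → ℂ) :
    star (shift s ψ) ⬝ᵥ φ = star ψ ⬝ᵥ shift (-s) φ := by
  simp only [dotProduct, Fintype.sum_prod_type, Fintype.sum_option, Pi.star_apply]
  refine congr_arg₂ _ rfl (Finset.sum_congr rfl fun i _ => ?_)
  rw [← Equiv.sum_comp (Equiv.addRight (s i))]
  simp [shift]

variable {X D : Type*} [Fintype X] [DecidableEq D] {a : X → ι → D} {κ : ℝ} {M : Matrix X X ℂ}

theorem IsMultiplicativeAdversary.potential_shift_le (h : IsMultiplicativeAdversary a κ M)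
    {s : X → ι → G} (hs : ∀ x y i, a x i = a y i → s x i = s y i) (Φ : X → Basis ι G m → ℂ) :
    potential M (fun x => shift (s x) (Φ x)) ≤ (1 + 2 * κ) * potential M Φ := by
  rw [potential_eq_add_sum_sum, potential_eq_add_sum_sum M Φ, mul_add]
  have hidle := potential_nonneg h.posDef.posSemidef fun x (p : G × Fin m) => Φ x (none, p)
  have hfactor : 1 ≤ 1 + 2 * κ := by linarith [h.nonneg]
  refine add_le_add (le_mul_of_one_le_left hidle hfactor) ?_
  simp only [Finset.mul_sum]
  refine Finset.sum_le_sum fun i _ => Finset.sum_le_sum fun w _ => ?_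
  obtain ⟨L, hL, hLM, hdom⟩ := h.exists_le i
  exact potential_translate_le h.nonneg hL hLM hdom (fun x y => hs x y i)
    fun x g => Φ x (some i, g, w)

end Query

/-! ### Running an algorithm backwards -/

namespace Algorithm

variable {ι D G E X : Type*} [Fintype ι] [DecidableEq ι] [Fintype G] [DecidableEq G]
  [AddCommGroup G]

/-- The adjoint of the first `t` queries of the algorithm, together with the unitaries
`U 0, …, U t`. -/
def adjointRun (A : Algorithm ι G E) (enc : D ↪ G) (x : ι → D) :
    ℕ → (Basis ι G A.workDim → ℂ) → (Basis ι G A.workDim → ℂ)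
  | 0, ψ => (A.U 0 : Matrix _ _ ℂ)ᴴ *ᵥ ψ
  | t + 1, ψ =>
    A.adjointRun enc x t (shift (-fun i => enc (x i)) ((A.U (t + 1) : Matrix _ _ ℂ)ᴴ *ᵥ ψ))

variable (A : Algorithm ι G E) (enc : D ↪ G)

theorem star_state_dotProduct (x : ι → D) (t : ℕ) (ψ : Basis ι G A.workDim → ℂ) :
    star (A.state enc x t) ⬝ᵥ ψ = A.adjointRun enc x t ψ A.start := by
  induction t generalizing ψ with
  | zero =>
    rw [state, Matrix.star_mulVec, ← Matrix.dotProduct_mulVec, adjointRun, ← Pi.single_star,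
      star_one, single_one_dotProduct]
  | succ t ih =>
    rw [state, Matrix.star_mulVec, ← Matrix.dotProduct_mulVec, query_eq_shift,
      star_shift_dotProduct, ih, adjointRun]

theorem adjointRun_project_start [DecidableEq E] (x : ι → D) (c : ℂ) (e : E) :
    A.adjointRun enc x A.numQueries
        (fun b => if A.out b = e then (c • A.state enc x A.numQueries) b else 0) A.start =
      c * A.outputProb enc x e := by
  rw [← star_state_dotProduct, outputProb, Finset.sum_filter, Complex.ofReal_sum, Finset.mul_sum,
    dotProduct]
  congr! 1 with b
  split_ifs with hb
  · rw [Complex.ofReal_pow, ← Complex.conj_mul', Pi.smul_apply, smul_eq_mul]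
    exact mul_left_comm _ _ _
  · simp

variable [Fintype X] [DecidableEq D] {enc} {a : X → ι → D} {κ : ℝ} {M : Matrix X X ℂ}

theorem potential_state_le (h : IsMultiplicativeAdversary a κ M) (w : X → ℂ) (t : ℕ) :
    potential M (fun x => w x • A.state enc (a x) t) ≤ (1 + 2 * κ) ^ t * quadForm M w := by
  induction t with
  | zero =>
    simp only [state, ← Matrix.mulVec_smul, pow_zero, one_mul]
    rw [potential_unitary_mulVec M, potential, Fintype.sum_eq_single A.start fun b hb => ?_]
    · simp
    · simp only [Pi.smul_apply, Pi.single_eq_of_ne hb, smul_zero]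
      exact quadForm_zero_right M
  | succ t ih =>
    simp only [state, ← Matrix.mulVec_smul, query_eq_shift, ← shift_smul]
    rw [potential_unitary_mulVec M, pow_succ', mul_assoc]
    exact (h.potential_shift_le (fun x y i hxy => congrArg enc hxy) _).trans
      (mul_le_mul_of_nonneg_left ih (by linarith [h.nonneg]))

theorem potential_adjointRun_le (h : IsMultiplicativeAdversary a κ M) (t : ℕ)
    (Φ : X → Basis ι G A.workDim → ℂ) :
    potential M (fun x => A.adjointRun enc (a x) t (Φ x)) ≤ (1 + 2 * κ) ^ t * potential M Φ := by
  induction t generalizing Φ with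
  | zero =>
    simp only [adjointRun]
    rw [potential_conjTranspose_mulVec M, pow_zero, one_mul]
  | succ t ih =>
    simp only [adjointRun]
    rw [pow_succ, mul_assoc, ← potential_conjTranspose_mulVec M (A.U (t + 1)) Φ]
    exact (ih _).trans (mul_le_mul_of_nonneg_left
      (h.potential_shift_le (fun x y i hxy => congrArg (-enc ·) hxy) _)
      (pow_nonneg (by linarith [h.nonneg]) t))

variable [DecidableEq E]

/-- For each output `e`, run the algorithm, project onto the output `e` and run it backwards: the
amplitude left in the initial state on input `x` is the probability of `e`. -/
theorem sum_quadForm_outputProb_le (h : IsMultiplicativeAdversary a κ M) (w : X → ℂ) {S : Finset E}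
    (hS : ∀ b, A.out b ∈ S) :
    ∑ e ∈ S, quadForm M (fun x => w x * A.outputProb enc (a x) e) ≤
      (1 + 2 * κ) ^ (2 * A.numQueries) * quadForm M w := by
  set Φ : X → Basis ι G A.workDim → ℂ := fun x => w x • A.state enc (a x) A.numQueries
  have hr : 0 ≤ (1 + 2 * κ) ^ A.numQueries := pow_nonneg (by linarith [h.nonneg]) _
  calc ∑ e ∈ S, quadForm M (fun x => w x * A.outputProb enc (a x) e)
    _ ≤ ∑ e ∈ S, (1 + 2 * κ) ^ A.numQueries *
          potential M (fun x b => if A.out b = e then Φ x b else 0) := by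
        gcongr with e
        simp only [← adjointRun_project_start]
        exact (quadForm_le_potential h.posDef.posSemidef _ A.start).trans
          (A.potential_adjointRun_le h _ _)
    _ = (1 + 2 * κ) ^ A.numQueries * potential M Φ := by
        rw [← Finset.mul_sum, sum_potential_fiber M Φ hS]
    _ ≤ (1 + 2 * κ) ^ A.numQueries * ((1 + 2 * κ) ^ A.numQueries * quadForm M w) :=
        mul_le_mul_of_nonneg_left (A.potential_state_le h w _) hr
    _ = (1 + 2 * κ) ^ (2 * A.numQueries) * quadForm M w := by ring

theorem sq_le_of_isMultiplicativeAdversary [DecidableEq X] (h : IsMultiplicativeAdversary a κ M)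
    {g : X → E} {η : ℝ} (hη : 0 ≤ η) (hA : ∀ x, η ≤ A.outputProb enc (a x) (g x)) {w : X → ℂ}
    (hw : ∑ x, ‖w x‖ ^ 2 = 1) :
    η ^ 2 ≤ (1 + 2 * κ) ^ (2 * A.numQueries) * quadForm M w * quadForm (M⁻¹ ⊙ gram g) w := by
  set S : Finset E := Finset.univ.image A.out ∪ Finset.univ.image g with hS
  set u : E → X → ℂ := fun e x => w x * A.outputProb enc (a x) e with hu
  set t : E → X → ℂ := fun e x => if g x = e then w x else 0 with ht
  have hout (b) : A.out b ∈ S := by simp [hS]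
  have hg (x) : g x ∈ S := by simp [hS]
  have hdot : ∑ e ∈ S, (star (t e) ⬝ᵥ u e).re =
      ∑ x, ‖w x‖ ^ 2 * A.outputProb enc (a x) (g x) := by
    simp only [dotProduct, Complex.re_sum]
    rw [Finset.sum_comm]
    congr! 1 with x
    rw [Finset.sum_eq_single_of_mem (g x) (hg x) fun e _ he => by simp [ht, he.symm]]
    simp only [ht, hu, Pi.star_apply, if_true]
    rw [← mul_assoc, ← starRingEnd_apply, Complex.conj_mul', ← Complex.ofReal_pow,
      ← Complex.ofReal_mul, Complex.ofReal_re]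
  have hηdot : η ≤ ∑ e ∈ S, (star (t e) ⬝ᵥ u e).re := by
    rw [hdot, ← one_mul η, ← hw, Finset.sum_mul]
    exact Finset.sum_le_sum fun x _ => mul_le_mul_of_nonneg_left (hA x) (sq_nonneg _)
  calc η ^ 2 ≤ (∑ e ∈ S, (star (t e) ⬝ᵥ u e).re) ^ 2 := pow_le_pow_left₀ hη hηdot 2
    _ ≤ (∑ e ∈ S, quadForm M (u e)) * ∑ e ∈ S, quadForm M⁻¹ (t e) :=
        sq_sum_re_dotProduct_le_mul_sum_quadForm_inv h.posDef S t u
    _ = (∑ e ∈ S, quadForm M (u e)) * quadForm (M⁻¹ ⊙ gram g) w := by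
        rw [sum_quadForm_fiber_eq_quadForm_hadamard_gram M⁻¹ g hg w]
    _ ≤ _ := mul_le_mul_of_nonneg_right (A.sum_quadForm_outputProb_le h w hout)
        (quadForm_nonneg (h.posDef.inv.posSemidef.hadamard (posSemidef_gram g)) w)

end Algorithm

/-! ### Tensor products -/

section Tensor

variable {P : Type*} [Fintype P] {X : P → Type*}

/-- The tensor product of a family of matrices, with rows and columns indexed by tuples. -/
def tensor {R : Type*} [CommSemiring R] (M : ∀ p, Matrix (X p) (X p) R) :
    Matrix (∀ p, X p) (∀ p, X p) R :=
  Matrix.of fun x y => ∏ p, M p (x p) (y p)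

section CommSemiring

variable {R : Type*} [CommSemiring R]

theorem tensor_apply (M : ∀ p, Matrix (X p) (X p) R) (x y : ∀ p, X p) :
    tensor M x y = ∏ p, M p (x p) (y p) :=
  rfl

theorem tensor_update_apply [DecidableEq P] (M : ∀ p, Matrix (X p) (X p) R) (p : P)
    (A : Matrix (X p) (X p) R) (x y : ∀ p, X p) :
    tensor (Function.update M p A) x y =
      A (x p) (y p) * ∏ q ∈ Finset.univ.erase p, M q (x q) (y q) := by
  rw [tensor_apply, ← Finset.mul_prod_erase _ _ (Finset.mem_univ p), Function.update_self]
  congr! 2 with q hq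
  rw [Function.update_of_ne (Finset.ne_of_mem_erase hq)]

theorem tensor_update_add [DecidableEq P] (M : ∀ p, Matrix (X p) (X p) R) (p : P)
    (A B : Matrix (X p) (X p) R) : tensor (Function.update M p (A + B)) =
      tensor (Function.update M p A) + tensor (Function.update M p B) := by
  ext x y
  simp only [Matrix.add_apply, tensor_update_apply, add_mul]

theorem tensor_update_sub {R : Type*} [CommRing R] [DecidableEq P]
    (M : ∀ p, Matrix (X p) (X p) R) (p : P) (A B : Matrix (X p) (X p) R) :
    tensor (Function.update M p (A - B)) =
      tensor (Function.update M p A) - tensor (Function.update M p B) := by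
  ext x y
  simp only [Matrix.sub_apply, tensor_update_apply, sub_mul]

theorem tensor_hadamard (M N : ∀ p, Matrix (X p) (X p) R) :
    tensor M ⊙ tensor N = tensor fun p => M p ⊙ N p := by
  ext x y
  exact Finset.prod_mul_distrib.symm

theorem tensor_one [∀ p, DecidableEq (X p)] :
    tensor (fun p => (1 : Matrix (X p) (X p) R)) = 1 := by
  ext x y
  simp only [tensor_apply, Matrix.one_apply, Finset.prod_ite_zero, Finset.prod_const_one,
    Finset.mem_univ, true_imp_iff, funext_iff]

theorem tensor_mul [DecidableEq P] [∀ p, Fintype (X p)] (M N : ∀ p, Matrix (X p) (X p) R) :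
    tensor M * tensor N = tensor fun p => M p * N p := by
  ext x y
  simp only [tensor_apply, Matrix.mul_apply, ← Finset.prod_mul_distrib, Fintype.prod_sum]

theorem tensor_mulVec_prod [DecidableEq P] [∀ p, Fintype (X p)] (M : ∀ p, Matrix (X p) (X p) R)
    (v : ∀ p, X p → R) :
    tensor M *ᵥ (fun x => ∏ p, v p (x p)) = fun x => ∏ p, (M p *ᵥ v p) (x p) := by
  ext x
  simp only [tensor_apply, Matrix.mulVec, dotProduct, ← Finset.prod_mul_distrib, Fintype.prod_sum]

end CommSemiring

theorem tensor_gram {E : P → Type*} [∀ p, DecidableEq (E p)] (f : ∀ p, X p → E p) :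
    tensor (fun p => gram (f p)) = gram fun (x : ∀ p, X p) p => f p (x p) := by
  ext x y
  simp only [tensor, gram, Matrix.of_apply, Finset.prod_ite_zero, Finset.prod_const_one,
    Finset.mem_univ, true_imp_iff, funext_iff]

theorem posSemidef_tensor {M : ∀ p, Matrix (X p) (X p) ℂ} (hM : ∀ p, (M p).PosSemidef) :
    (tensor M).PosSemidef := by
  classical
  suffices ∀ s : Finset P,
      (Matrix.of fun x y : ∀ p, X p => ∏ p ∈ s, M p (x p) (y p)).PosSemidef from this Finset.univ
  intro s
  induction s using Finset.induction_on with
  | empty =>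
    convert posSemidef_gram fun _ : ∀ p, X p => () using 1
    ext x y
    simp [gram]
  | insert p s hp ih =>
    have : (Matrix.of fun x y : ∀ p, X p => ∏ q ∈ insert p s, M q (x q) (y q)) =
        (M p).submatrix (fun x => x p) (fun x => x p) ⊙
          Matrix.of fun x y => ∏ q ∈ s, M q (x q) (y q) := by
      ext x y
      simp [Finset.prod_insert hp]
    rw [this]
    exact ((hM p).submatrix fun x : ∀ p, X p => x p).hadamard ih

theorem posSemidef_tensor_update [DecidableEq P] {M : ∀ p, Matrix (X p) (X p) ℂ}
    (hM : ∀ p, (M p).PosSemidef) {p : P} {A : Matrix (X p) (X p) ℂ} (hA : A.PosSemidef) :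
    (tensor (Function.update M p A)).PosSemidef :=
  posSemidef_tensor ((Function.forall_update_iff M fun _ => Matrix.PosSemidef).mpr
    ⟨hA, fun q _ => hM q⟩)

theorem IsDominatedBy.tensor_update [DecidableEq P] {M : ∀ p, Matrix (X p) (X p) ℂ}
    (hM : ∀ p, (M p).PosSemidef) {p : P} {N L : Matrix (X p) (X p) ℂ} (h : IsDominatedBy N L) :
    IsDominatedBy (tensor (Function.update M p N)) (tensor (Function.update M p L)) :=
  ⟨tensor_update_add M p L N ▸ posSemidef_tensor_update hM h.1,
    tensor_update_sub M p L N ▸ posSemidef_tensor_update hM h.2⟩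

section Fintype

variable [DecidableEq P] [∀ p, Fintype (X p)]

theorem sum_norm_prod_sq (v : ∀ p, X p → ℂ) :
    ∑ x : ∀ p, X p, ‖∏ p, v p (x p)‖ ^ 2 = ∏ p, ∑ x, ‖v p x‖ ^ 2 := by
  simp only [norm_prod, ← Finset.prod_pow, Fintype.prod_sum]

theorem quadForm_tensor_prod {M : ∀ p, Matrix (X p) (X p) ℂ} (hM : ∀ p, (M p).PosSemidef)
    (v : ∀ p, X p → ℂ) :
    quadForm (tensor M) (fun x => ∏ p, v p (x p)) = ∏ p, quadForm (M p) (v p) := by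
  rw [← Complex.ofReal_inj, Complex.ofReal_prod, ofReal_quadForm (posSemidef_tensor hM)]
  simp only [ofReal_quadForm (hM _), tensor_mulVec_prod, dotProduct, Pi.star_apply, star_prod,
    ← Finset.prod_mul_distrib, Fintype.prod_sum]

variable [∀ p, DecidableEq (X p)]

theorem tensor_mul_tensor_inv {M : ∀ p, Matrix (X p) (X p) ℂ} (hM : ∀ p, (M p).PosDef) :
    tensor M * tensor (fun p => (M p)⁻¹) = 1 := by
  have hdet (p : P) : IsUnit (M p).det := (Matrix.isUnit_iff_isUnit_det _).mp (hM p).isUnit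
  simp only [tensor_mul, Matrix.mul_nonsing_inv _ (hdet _), tensor_one]

theorem tensor_inv {M : ∀ p, Matrix (X p) (X p) ℂ} (hM : ∀ p, (M p).PosDef) :
    (tensor M)⁻¹ = tensor fun p => (M p)⁻¹ :=
  Matrix.inv_eq_right_inv (tensor_mul_tensor_inv hM)

end Fintype

variable [∀ p, Finite (X p)]

theorem posDef_tensor {M : ∀ p, Matrix (X p) (X p) ℂ} (hM : ∀ p, (M p).PosDef) :
    (tensor M).PosDef := by
  classical
  have (p : P) : Fintype (X p) := Fintype.ofFinite (X p)
  exact (posSemidef_tensor fun p => (hM p).posSemidef).posDef_iff_isUnit.mpr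
    (IsUnit.of_mul_eq_one _ (tensor_mul_tensor_inv hM))

/-- The position `(p, i)` is read in the `p`-th factor only, so that its lower bound is the tensor
product in which the `p`-th factor is replaced by its own lower bound. -/
theorem IsMultiplicativeAdversary.tensor {ι D : Type*} [DecidableEq D] {a : ∀ p, X p → ι → D}
    {κ : ℝ} (hκ : 0 ≤ κ) {S : ∀ p, Matrix (X p) (X p) ℂ}
    (h : ∀ p, IsMultiplicativeAdversary (a p) κ (S p)) :
    IsMultiplicativeAdversary (fun (y : ∀ p, X p) (q : P × ι) => a q.1 (y q.1) q.2) κ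
      (tensor S) where
  nonneg := hκ
  posDef := posDef_tensor fun p => (h p).posDef
  exists_le := by
    classical
    rintro ⟨p, i⟩
    obtain ⟨L, hL, hLS, hdom⟩ := (h p).exists_le i
    have hS (q) : (S q).PosSemidef := (h q).posDef.posSemidef
    have hSp : QuantumQuery.tensor S = QuantumQuery.tensor (Function.update S p (S p)) := by
      rw [Function.update_eq_self]
    have hblock : QuantumQuery.tensor S ⊙ (allOnes _ - gram fun y => a p (y p) i) =
        QuantumQuery.tensor
          (Function.update S p (S p ⊙ (allOnes _ - gram fun x => a p x i))) := by
      ext x y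
      rw [Matrix.hadamard_apply, hSp, tensor_update_apply, tensor_update_apply]
      exact mul_right_comm _ _ _
    have hsmul : κ • QuantumQuery.tensor (Function.update S p L) =
        QuantumQuery.tensor (Function.update S p (κ • L)) := by
      ext x y
      simp only [Matrix.smul_apply, tensor_update_apply, smul_mul_assoc]
    refine ⟨QuantumQuery.tensor (Function.update S p L), fun x y hxy => ?_, ?_, ?_⟩
    · rw [tensor_update_apply, hL _ _ hxy, zero_mul]
    · rw [hSp, ← tensor_update_sub]
      exact posSemidef_tensor_update hS hLS
    · rw [hblock, hsmul]
      exact hdom.tensor_update hS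

end Tensor

/-! ### From additive to multiplicative adversary matrices -/

section Additive

theorem isHermitian_allOnes (X : Type*) : (allOnes X).IsHermitian := by
  ext x y
  simp [allOnes]

variable {X E : Type*} [DecidableEq E]

theorem hadamard_allOnes_sub_gram_hadamard_gram (M : Matrix X X ℂ) (f : X → E) :
    M ⊙ (allOnes X - gram f) ⊙ gram f = 0 := by
  ext x y
  by_cases h : f x = f y <;> simp [allOnes, gram, h]

variable [DecidableEq X]

theorem one_hadamard_allOnes_sub_gram (f : X → E) :
    (1 : Matrix X X ℂ) ⊙ (allOnes X - gram f) = 0 := by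
  rw [hadamard_allOnes_sub, one_hadamard_gram, sub_self]

theorem isMultiplicativeAdversary_two_smul_one_sub {ι D : Type*} [DecidableEq D] {a : X → ι → D}
    {κ : ℝ} (hκ : 0 ≤ κ) {H : Matrix X X ℂ} (hH : IsDominatedBy H 1)
    (hadv : ∀ i, IsDominatedBy (H ⊙ (allOnes X - gram fun x => a x i)) (κ • 1)) :
    IsMultiplicativeAdversary a κ ((2 : ℝ) • 1 - H) where
  nonneg := hκ
  posDef := posDef_two_smul_one_sub hH
  exists_le i := by
    have hblock : ((2 : ℝ) • 1 - H) ⊙ (allOnes X - gram fun x => a x i) =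
        -(H ⊙ (allOnes X - gram fun x => a x i)) := by
      rw [sub_hadamard, Matrix.smul_hadamard, one_hadamard_allOnes_sub_gram, smul_zero, zero_sub]
    refine ⟨1, fun x y hxy => Matrix.one_apply_ne (ne_of_apply_ne (a · i) hxy), ?_, ?_⟩
    · have : (2 : ℝ) • 1 - H - 1 = 1 - H := by module
      exact this ▸ hH.2
    · exact hblock ▸ (hadv i).neg

variable {ι D : Type*} [Fintype ι] [DecidableEq D] {𝒟 : Finset (ι → D)}

theorem IsAdversaryMatrix.isDominatedBy_hadamard {f : 𝒟 → E} {Γ : Matrix 𝒟 𝒟 ℂ}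
    (hΓ : IsAdversaryMatrix 𝒟 Γ) (i : ι) :
    IsDominatedBy (Γ ⊙ (allOnes 𝒟 - gram f) ⊙ (allOnes 𝒟 - agree 𝒟 i)) ((2 : ℝ) • 1) := by
  have hN : IsDominatedBy (Γ ⊙ (allOnes 𝒟 - agree 𝒟 i)) 1 := hΓ.2 i
  have hNF : IsDominatedBy (Γ ⊙ (allOnes 𝒟 - agree 𝒟 i) ⊙ gram f) 1 :=
    one_hadamard_gram f ▸ hN.hadamard (posSemidef_gram f)
  have hswap : Γ ⊙ (allOnes 𝒟 - gram f) ⊙ (allOnes 𝒟 - agree 𝒟 i) =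
      Γ ⊙ (allOnes 𝒟 - agree 𝒟 i) - Γ ⊙ (allOnes 𝒟 - agree 𝒟 i) ⊙ gram f := by
    rw [Matrix.hadamard_assoc, Matrix.hadamard_comm (allOnes 𝒟 - gram f), ← Matrix.hadamard_assoc,
      hadamard_allOnes_sub _ (gram f)]
  rw [hswap, two_smul]
  exact hN.sub hNF

end Additive

section DirectProduct

variable {ι D : Type*} [Fintype ι] [DecidableEq ι] [Fintype D] [DecidableEq D]
  {E G : Type*} [DecidableEq E] [Fintype G] [DecidableEq G] [AddCommGroup G]
  {enc : D ↪ G} {𝒟 : Finset (ι → D)} {f : 𝒟 → E} {k : ℕ}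
  {A : Algorithm (Fin k × ι) G (Fin k → E)} {η : ℝ}

theorem Algorithm.Computes.le_outputProb_funPow
    (hA : A.Computes enc (1 - η) (funPow k f)) (y : Fin k → 𝒟) :
    η ≤ A.outputProb enc (fun q => (y q.1).1 q.2) fun p => f (y p) := by
  have := hA ⟨fun q => (y q.1).1 q.2, by simp [powDomain]⟩
  rwa [sub_sub_cancel] at this

theorem sq_le_pow_mul_quadForm_mul_quadForm_inv_pow {κ : ℝ} {S : Matrix 𝒟 𝒟 ℂ}
    (hS : IsMultiplicativeAdversary Subtype.val κ S) {v : 𝒟 → ℂ} (hv : ∑ x, ‖v x‖ ^ 2 = 1)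
    (hη : 0 ≤ η) (hA : A.Computes enc (1 - η) (funPow k f)) :
    η ^ 2 ≤ (1 + 2 * κ) ^ (2 * A.numQueries) *
      (quadForm S v * quadForm (S⁻¹ ⊙ gram f) v) ^ k := by
  have hpow := IsMultiplicativeAdversary.tensor hS.nonneg fun _ : Fin k => hS
  have hunit : ∑ y : Fin k → 𝒟, ‖∏ p, v (y p)‖ ^ 2 = 1 := by
    rw [sum_norm_prod_sq fun _ : Fin k => v, hv, Finset.prod_const_one]
  have hmain := A.sq_le_of_isMultiplicativeAdversary hpow hη hA.le_outputProb_funPow hunit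
  have hSinv : (S⁻¹ ⊙ gram f).PosSemidef :=
    hS.posDef.inv.posSemidef.hadamard (posSemidef_gram f)
  rwa [tensor_inv fun _ => hS.posDef, ← tensor_gram fun _ => f, tensor_hadamard,
    quadForm_tensor_prod fun _ => hS.posDef.posSemidef, quadForm_tensor_prod fun _ => hSinv,
    Finset.prod_const, Finset.prod_const, Finset.card_univ, Fintype.card_fin, mul_assoc,
    ← mul_pow] at hmain

theorem sq_le_pow_mul_two_thirds_pow {κ : ℝ} (hκ : 0 ≤ κ) {H : Matrix 𝒟 𝒟 ℂ}
    (hH : IsDominatedBy H 1) (hf : H ⊙ gram f = 0)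
    (hadv : ∀ i, IsDominatedBy (H ⊙ (allOnes 𝒟 - agree 𝒟 i)) (κ • 1)) {v : 𝒟 → ℂ}
    (hv : ∑ x, ‖v x‖ ^ 2 = 1) (hHv : H *ᵥ v = v) (hη : 0 ≤ η)
    (hA : A.Computes enc (1 - η) (funPow k f)) :
    η ^ 2 ≤ (1 + 2 * κ) ^ (2 * A.numQueries) * (2 / 3) ^ k := by
  have hS : IsMultiplicativeAdversary Subtype.val κ ((2 : ℝ) • 1 - H) :=
    isMultiplicativeAdversary_two_smul_one_sub hκ hH hadv
  have hSv : quadForm ((2 : ℝ) • 1 - H) v = 1 := by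
    rw [quadForm_of_mulVec_eq_smul (c := 1), hv, one_mul]
    rw [Matrix.sub_mulVec, Matrix.smul_mulVec, Matrix.one_mulVec, hHv]
    module
  have hSinv : quadForm (((2 : ℝ) • 1 - H)⁻¹ ⊙ gram f) v ≤ 2 / 3 := by
    simpa only [hv, mul_one] using quadForm_inv_hadamard_gram_le hH hf v
  have hmain := sq_le_pow_mul_quadForm_mul_quadForm_inv_pow hS hv hη hA
  rw [hSv, one_mul] at hmain
  have hnonneg : 0 ≤ quadForm (((2 : ℝ) • 1 - H)⁻¹ ⊙ gram f) v :=
    quadForm_nonneg (hS.posDef.inv.posSemidef.hadamard (posSemidef_gram f)) v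
  refine hmain.trans ?_
  gcongr

theorem sq_le_pow_of_isAdversaryMatrix {Γ : Matrix 𝒟 𝒟 ℂ} (hΓ : IsAdversaryMatrix 𝒟 Γ)
    (hd : 0 < specNorm (Γ ⊙ (allOnes 𝒟 - gram f))) (hη : 0 ≤ η)
    (hA : A.Computes enc (1 - η) (funPow k f)) :
    η ^ 2 ≤ (1 + 2 * (2 / specNorm (Γ ⊙ (allOnes 𝒟 - gram f)))) ^ (2 * A.numQueries) *
      (2 / 3) ^ k := by
  set B := Γ ⊙ (allOnes 𝒟 - gram f) with hB
  have hBherm : B.IsHermitian :=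
    hΓ.1.hadamard ((isHermitian_allOnes 𝒟).sub (posSemidef_gram f).isHermitian)
  have : Nonempty 𝒟 := by
    by_contra hempty
    rw [not_nonempty_iff] at hempty
    rw [Subsingleton.elim B 0] at hd
    simp [specNorm] at hd
  obtain ⟨c, v, hc, hv, hBv⟩ := exists_mulVec_eq_smul_and_abs_eq_specNorm hBherm
  have hc0 : c ≠ 0 := abs_pos.mp (hc ▸ hd)
  have habs : |c⁻¹| = (specNorm B)⁻¹ := by rw [abs_inv, hc]
  refine sq_le_pow_mul_two_thirds_pow (H := c⁻¹ • B) (by positivity) ?_ ?_ (fun i => ?_) hv ?_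
    hη hA
  · simpa only [habs, smul_smul, inv_mul_cancel₀ hd.ne', one_smul] using
      (isDominatedBy_specNorm_smul_one hBherm).smul c⁻¹
  · rw [Matrix.smul_hadamard, hB, hadamard_allOnes_sub_gram_hadamard_gram, smul_zero]
  · simpa only [habs, smul_smul, Matrix.smul_hadamard, ← div_eq_inv_mul] using
      (hΓ.isDominatedBy_hadamard i).smul c⁻¹
  · rw [Matrix.smul_mulVec, hBv, inv_smul_smul₀ hc0]

theorem natCast_mul_log_le_of_pow_le_one_add_pow {x c : ℝ} (hx : 0 < x) (hc : 0 ≤ c) {m n : ℕ}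
    (h : x ^ n ≤ (1 + c) ^ m) : n * Real.log x ≤ m * c := by
  have hlog := Real.log_le_log (pow_pos hx n) h
  rw [Real.log_pow, Real.log_pow] at hlog
  have hc' : Real.log (1 + c) ≤ c := by
    linarith [Real.log_le_sub_one_of_pos (add_pos_of_pos_of_nonneg one_pos hc)]
  exact hlog.trans (mul_le_mul_of_nonneg_left hc' m.cast_nonneg)

theorem mul_specNorm_le_numQueries {Γ : Matrix 𝒟 𝒟 ℂ} (hΓ : IsAdversaryMatrix 𝒟 Γ) {δ : ℝ}
    (hδ : 0 < δ) (hA : A.Computes enc (1 - δ ^ ((k : ℝ) / 2)) (funPow k f)) :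
    k * Real.log (3 * δ / 2) / 8 * specNorm (Γ ⊙ (allOnes 𝒟 - gram f)) ≤ A.numQueries := by
  have hd0 : 0 ≤ specNorm (Γ ⊙ (allOnes 𝒟 - gram f)) := norm_nonneg _
  rcases hd0.eq_or_lt with h0 | hd
  · rw [← h0, mul_zero]
    exact Nat.cast_nonneg _
  have hsq := sq_le_pow_of_isAdversaryMatrix hΓ hd (Real.rpow_nonneg hδ.le _) hA
  set d := specNorm (Γ ⊙ (allOnes 𝒟 - gram f))
  have hδsq : (δ ^ ((k : ℝ) / 2)) ^ 2 = δ ^ k := by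
    rw [← Real.rpow_mul_natCast hδ.le, Nat.cast_ofNat, div_mul_cancel₀ _ two_ne_zero,
      Real.rpow_natCast]
  rw [hδsq] at hsq
  have hpow : (3 * δ / 2) ^ k ≤ (1 + 2 * (2 / d)) ^ (2 * A.numQueries) := by
    calc (3 * δ / 2) ^ k = δ ^ k * (3 / 2) ^ k := by rw [← mul_pow]; ring
      _ ≤ (1 + 2 * (2 / d)) ^ (2 * A.numQueries) * (2 / 3) ^ k * (3 / 2) ^ k := by gcongr
      _ = (1 + 2 * (2 / d)) ^ (2 * A.numQueries) := by rw [mul_assoc, ← mul_pow]; norm_num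
  have hlog := natCast_mul_log_le_of_pow_le_one_add_pow (by positivity) (by positivity) hpow
  calc k * Real.log (3 * δ / 2) / 8 * d
    _ ≤ (2 * A.numQueries : ℕ) * (2 * (2 / d)) / 8 * d := by gcongr
    _ = A.numQueries := by push_cast; field_simp; ring

end DirectProduct

end QuantumQuery

theorem mainTheorem5_general {ι D E G : Type*} [Fintype ι] [DecidableEq ι] [Fintype D]
    [DecidableEq D] [DecidableEq E] [Fintype G] [DecidableEq G] [AddCommGroup G] (enc : D ↪ G)
    (𝒟 : Finset (ι → D)) (f : 𝒟 → E) (δ : ℝ) (hδ : 2 / 3 ≤ δ) (k : ℕ) :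
    ENNReal.ofReal (k * Real.log (3 * δ / 2) / 8) *
        QuantumQuery.advBound (QuantumQuery.gram f) ≤
      ((QuantumQuery.queryComplexity enc (1 - δ ^ ((k : ℝ) / 2))
        (QuantumQuery.funPow k f) : ℕ∞) : ℝ≥0∞) := by
  have hlog : 0 ≤ k * Real.log (3 * δ / 2) / 8 := by
    have := Real.log_nonneg (x := 3 * δ / 2) (by linarith)
    positivity
  simp only [QuantumQuery.advBound, QuantumQuery.queryComplexity, ENat.toENNReal_iInf,
    ENNReal.mul_iSup]
  refine iSup₂_le fun Γ hΓ => le_iInf₂ fun A hA => ?_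
  rw [← ENNReal.ofReal_mul hlog, ENat.toENNReal_coe, ← ENNReal.ofReal_natCast]
  exact ENNReal.ofReal_le_ofReal
    (QuantumQuery.mul_specNorm_le_numQueries hΓ (by linarith) hA)

theorem mainTheorem5 {D E G : Type*} [Fintype D] [DecidableEq D] [DecidableEq E]
    [Fintype G] [DecidableEq G] [AddCommGroup G] (enc : D ↪ G)
    {n : ℕ} (𝒟 : Finset (Fin n → D)) (f : 𝒟 → E)
    (δ : ℝ) (hδ : 2 / 3 ≤ δ) (hδ1 : δ ≤ 1) (k : ℕ) (hk : 0 < k) :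
    ENNReal.ofReal (k * Real.log (3 * δ / 2) / 8) *
        QuantumQuery.advBound (QuantumQuery.gram f) ≤
      ((QuantumQuery.queryComplexity enc (1 - δ ^ ((k : ℝ) / 2))
        (QuantumQuery.funPow k f) : ℕ∞) : ℝ≥0∞) :=
  mainTheorem5_general enc 𝒟 f δ hδ k
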